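/- Let $R$ and $Q$ be associative unital rings and let $\varphi\colon R\to Q$ be a left flat bimorphism, that is, $\varphi$ is both a monomorphism and an epimorphism in the category of rings and $Q$, viewed via $\varphi$, is flat as a left $R$-module. For a class $\mathcal A$ of left $R$-modules put ${}^{\perp}\mathcal A=\{M : \operatorname{Ext}^1_R(M,A)=0 \text{ for all } A\in\mathcal A\}$. A left $R$-module is called $h$-divisible if it is a homomorphic image, as an $R$-module, of a left $Q$-module, and a left $R$-module $D$ is called divisible if $ID=D$ for every right ideal $I$ of $R$ with $\varphi(I)Q=Q$. Let ${}_R\mathcal{HD}$, ${}_R\mathcal D$, ${}_R\mathcal P_1$ and ${}_R\mathcal F_1$ be the classes of all left $R$-modules that are, respectively, $h$-divisible, divisible, of projective dimension $\le 1$, and of weak (flat) dimension $\le 1$. Then: (i) ${}^{\perp}({}_R\mathcal{HD})\subseteq {}_R\mathcal P_1$. (ii) If ${}_R\mathcal F_1={}^{\perp}({}_R\mathcal D)$, then $\operatorname{Fdim}({}_QQ)=0$, that is, every left $Q$-module has projective dimension $0$ or $\infty$ (the zero module being counted as having projective dimension $0$), and $Q$ is left perfect, that is, every left $Q$-module has a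 projective cover. -/

import Mathlib

open CategoryTheory

universe u

noncomputable section

namespace FlatBimorphism

/-! ### Tensor products and flatness over a noncommutative ring

Right `R`-modules are modules over `Rᵐᵒᵖ`; the product `a r` is `MulOpposite.op r • a`. -/

section Tensor

open TensorProduct

variable (R : Type u) [Ring R] (A B : Type u) [AddCommGroup A] [Module Rᵐᵒᵖ A]
  [AddCommGroup B] [Module Rᵐᵒᵖ B] (M : Type u) [AddCommGroup M] [Module R M]

/-- The subgroup of `A ⊗ M` (over the integers) generated by all `(a r) ⊗ m - a ⊗ (r m)`. -/
def balancingRelations : AddSubgroup (A ⊗[ℤ] M) :=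
  AddSubgroup.closure
    {t | ∃ (a : A) (r : R) (m : M),
      t = (MulOpposite.op r • a) ⊗ₜ[ℤ] m - a ⊗ₜ[ℤ] (r • m)}

/-- The tensor product `A ⊗_R M` of a right `R`-module `A` and a left `R`-module `M`,
an abelian group. -/
abbrev BalancedTensor : Type u := (A ⊗[ℤ] M) ⧸ balancingRelations R A M

variable {A B}

/-- The homomorphism `f ⊗_R M : A ⊗_R M → B ⊗_R M` induced by a homomorphism `f : A → B` of
right `R`-modules. -/
def BalancedTensor.map (f : A →ₗ[Rᵐᵒᵖ] B) : BalancedTensor R A M →+ BalancedTensor R B M :=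
  QuotientAddGroup.map (balancingRelations R A M) (balancingRelations R B M)
    (LinearMap.rTensor M f.toAddMonoidHom.toIntLinearMap).toAddMonoidHom (by
      rw [balancingRelations, AddSubgroup.closure_le]
      rintro _ ⟨a, r, m, rfl⟩
      refine AddSubgroup.subset_closure ⟨f a, r, m, ?_⟩
      simp)

end Tensor

section Modules

variable {R : Type u} [Ring R]

/-- A left `R`-module `M` is flat if `- ⊗_R M` preserves injectivity of homomorphisms of right
`R`-modules. -/
def IsFlatModule (M : ModuleCat.{u} R) : Prop :=
  ∀ (A B : Type u) [AddCommGroup A] [AddCommGroup B] [Module Rᵐᵒᵖ A] [Module Rᵐᵒᵖ B]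
    (f : A →ₗ[Rᵐᵒᵖ] B),
    Function.Injective f → Function.Injective (BalancedTensor.map R M f)

/-- The class of left `R`-modules of projective dimension at most `1`. -/
def classP1 (R : Type u) [Ring R] : ObjectProperty (ModuleCat.{u} R) :=
  fun M => projectiveDimension M ≤ 1

/-- The class of left `R`-modules `M` of weak (flat) dimension at most `1`: there is an exact
sequence `0 → F₁ → F₀ → M → 0` with `F₁` and `F₀` flat. -/
def classF1 (R : Type u) [Ring R] : ObjectProperty (ModuleCat.{u} R) :=
  fun M => ∃ (F₁ F₀ : ModuleCat.{u} R) (i : F₁ →ₗ[R] F₀) (p : F₀ →ₗ[R] M),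
    IsFlatModule F₁ ∧ IsFlatModule F₀ ∧
      Function.Injective i ∧ Function.Exact i p ∧ Function.Surjective p

/-- The left orthogonal of a class `𝒜` of left `R`-modules: all `M` with `Ext¹(M, A) = 0` for
every `A` in `𝒜`. -/
def leftPerp (𝒜 : ObjectProperty (ModuleCat.{u} R)) : ObjectProperty (ModuleCat.{u} R) :=
  fun M => ∀ A : ModuleCat.{u} R, 𝒜 A → Subsingleton (Abelian.Ext.{u} M A 1)

/-- `Fdim = 0` for left modules: every left module has projective dimension `0` or `∞`.
(The zero module has projective dimension `⊥` in Mathlib, whence `≤`.) -/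
def LeftFdimEqZero (R : Type u) [Ring R] : Prop :=
  ∀ M : ModuleCat.{u} R, projectiveDimension M ≤ 0 ∨ projectiveDimension M = ⊤

/-- A ring is left perfect if every left module `M` has a projective cover, i.e. there is a
surjection `f : P → M` with `P` projective and with superfluous kernel. -/
def IsLeftPerfect (R : Type u) [Ring R] : Prop :=
  ∀ M : ModuleCat.{u} R, ∃ (P : ModuleCat.{u} R) (f : P →ₗ[R] M),
    Module.Projective R P ∧ Function.Surjective f ∧
      ∀ N : Submodule R P, N ⊔ LinearMap.ker f = ⊤ → N = ⊤

end Modules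

section Bimorphism

variable {R Q : Type u} [Ring R] [Ring Q]

/-- A left flat bimorphism: a monomorphism and epimorphism `φ : R → Q` in the category of
(associative unital) rings such that `Q` is flat as a left `R`-module. -/
structure IsLeftFlatBimorphism (φ : R →+* Q) : Prop where
  mono : Mono (RingCat.ofHom φ)
  epi : Epi (RingCat.ofHom φ)
  flat : IsFlatModule ((ModuleCat.restrictScalars φ).obj (ModuleCat.of Q Q))

/-- The class of `h`-divisible left `R`-modules: the homomorphic images of (restrictions of
scalars of) left `Q`-modules. -/
def classHD (φ : R →+* Q) : ObjectProperty (ModuleCat.{u} R) :=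
  fun D => ∃ (V : ModuleCat.{u} Q) (f : (ModuleCat.restrictScalars φ).obj V →ₗ[R] D),
    Function.Surjective f

/-- The set of right ideals `I` of `R` such that the right ideal `φ(I) Q` of `Q` is `Q`. -/
def gabrielFilter (φ : R →+* Q) : Set (Submodule Rᵐᵒᵖ R) :=
  {I | Submodule.span Qᵐᵒᵖ (φ '' (I : Set R)) = ⊤}

/-- The class of divisible left `R`-modules: `D = I D` for every right ideal `I` with
`φ(I) Q = Q`, where `I D` is the subgroup generated by all products `r d` with `r` in `I`. -/
def classD (φ : R →+* Q) : ObjectProperty (ModuleCat.{u} R) :=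
  fun D => ∀ I ∈ gabrielFilter φ,
    AddSubgroup.closure {x : D | ∃ r ∈ I, ∃ d : D, x = r • d} = ⊤

end Bimorphism

end FlatBimorphism

end

/-! Part (i) is dimension shifting: a quotient of an injective module is `h`-divisible, so `Ext²(M,
N)` is a quotient of some `Ext¹(M, E/N) = 0`.

Part (ii) rests on one fact, `IsLeftFlatBimorphism.exists_retraction`: every injection `K → F` of
projective `Q`-modules splits. Over `R` both modules are flat, so the cokernel lies in `F₁`, while
`K`, being a `Q`-module, is divisible. By hypothesis the sequence splits over `R`, and since `φ` is
an epimorphism the splitting is `Q`-linear.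

Finite projective dimensions then collapse to zero by taking syzygies. Applied to Bass's
endomorphism `e_n ↦ e_n - a_n e_{n+1}` of a free module, the splitting yields the descending chain
condition on principal right ideals. As in Bass's theorem, this makes `Q/J` semisimple (`J` the
Jacobson radical), makes `J` nil and gives Nakayama's lemma for all modules; lifting idempotents
then produces projective covers. -/

noncomputable section

namespace FlatBimorphism

/-! ### Flatness via dual bases -/

section Tensor

variable {R : Type u} [Ring R] {A B : Type u} [AddCommGroup A] [Module Rᵐᵒᵖ A]
  [AddCommGroup B] [Module Rᵐᵒᵖ B] {M N : Type u} [AddCommGroup M] [Module R M]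
  [AddCommGroup N] [Module R N]

/-- The homomorphism `A ⊗_R g : A ⊗_R M → A ⊗_R N` induced by a homomorphism `g : M → N` of
left `R`-modules. -/
def BalancedTensor.lMap (A : Type u) [AddCommGroup A] [Module Rᵐᵒᵖ A] (g : M →ₗ[R] N) :
    BalancedTensor R A M →+ BalancedTensor R A N :=
  QuotientAddGroup.map (balancingRelations R A M) (balancingRelations R A N)
    (LinearMap.lTensor A g.toAddMonoidHom.toIntLinearMap).toAddMonoidHom (by
      rw [balancingRelations, AddSubgroup.closure_le]
      rintro _ ⟨a, r, m, rfl⟩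
      refine AddSubgroup.subset_closure ⟨a, r, g m, ?_⟩
      simp)

/-- The class of the pure tensor `a ⊗ m` in `A ⊗_R M`. -/
def BalancedTensor.tmul (R : Type u) [Ring R] [Module Rᵐᵒᵖ A] [Module R M] (a : A) (m : M) :
    BalancedTensor R A M :=
  QuotientAddGroup.mk (TensorProduct.tmul ℤ a m)

@[simp]
theorem BalancedTensor.map_tmul (f : A →ₗ[Rᵐᵒᵖ] B) (a : A) (m : M) :
    BalancedTensor.map R M f (tmul R a m) = tmul R (f a) m := rfl

@[simp]
theorem BalancedTensor.lMap_tmul (g : M →ₗ[R] N) (a : A) (m : M) :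
    BalancedTensor.lMap A g (tmul R a m) = tmul R a (g m) := rfl

theorem BalancedTensor.tmul_sum {ι : Type*} (s : Finset ι) (a : A) (m : ι → M) :
    tmul R a (∑ i ∈ s, m i) = ∑ i ∈ s, tmul R a (m i) := by
  simp only [tmul, TensorProduct.tmul_sum]
  exact map_sum (QuotientAddGroup.mk' (balancingRelations R A M)) _ _

theorem BalancedTensor.induction {p : BalancedTensor R A M → Prop} (zero : p 0)
    (tmul : ∀ a m, p (tmul R a m)) (add : ∀ s t, p s → p t → p (s + t))
    (t : BalancedTensor R A M) : p t := by
  induction t using QuotientAddGroup.induction_on with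
  | H t =>
    induction t using TensorProduct.induction_on with
    | zero => exact zero
    | tmul a m => exact tmul a m
    | add s t hs ht => exact add _ _ hs ht

theorem BalancedTensor.map_lMap (f : A →ₗ[Rᵐᵒᵖ] B) (g : M →ₗ[R] N) (t : BalancedTensor R A M) :
    BalancedTensor.map R N f (lMap A g t) = lMap B g (BalancedTensor.map R M f t) := by
  induction t using BalancedTensor.induction with
  | zero => simp
  | tmul a m => simp
  | add s t hs ht => simp only [map_add, hs, ht]

/-- A module which is locally built from a flat module `N` by means of a dual basis is flat. -/
theorem IsFlatModule.of_dualBasis {M N : ModuleCat.{u} R} (hN : IsFlatModule N) {X : Type*}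
    (ev : X → M →ₗ[R] N) (ι : X → N →ₗ[R] M)
    (h : ∀ m, ∃ S : Finset X, ∀ T, S ⊆ T → ∑ x ∈ T, ι x (ev x m) = m) : IsFlatModule M := by
  classical
  intro A B _ _ _ _ f hf
  -- A tensor involves finitely many elements of `M`, so finitely many `x` recover it from its
  -- images in `A ⊗ N`, where flatness of `N` applies.
  have key (t : BalancedTensor R A M) : ∃ S : Finset X, ∀ T, S ⊆ T →
      ∑ x ∈ T, BalancedTensor.lMap A (ι x) (BalancedTensor.lMap A (ev x) t) = t := by
    induction t using BalancedTensor.induction with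
    | zero => exact ⟨∅, by simp⟩
    | tmul a m =>
      obtain ⟨S, hS⟩ := h m
      exact ⟨S, fun T hT => by
        simp only [BalancedTensor.lMap_tmul, ← BalancedTensor.tmul_sum, hS T hT]⟩
    | add s t hs ht =>
      obtain ⟨S, hS⟩ := hs
      obtain ⟨S', hS'⟩ := ht
      refine ⟨S ∪ S', fun T hT => ?_⟩
      simp only [map_add, Finset.sum_add_distrib]
      rw [hS T (Finset.union_subset_left hT), hS' T (Finset.union_subset_right hT)]
  rw [injective_iff_map_eq_zero]
  intro t ht
  obtain ⟨S, hS⟩ := key t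
  rw [← hS S subset_rfl]
  refine Finset.sum_eq_zero fun x _ => ?_
  have : BalancedTensor.lMap A (ev x) t = 0 := by
    apply (injective_iff_map_eq_zero _).1 (hN A B f hf)
    rw [BalancedTensor.map_lMap, ht, map_zero]
  rw [this, map_zero]

end Tensor

/-! ### Restriction of scalars, divisibility and splitting -/

section Bimorphism

variable {R Q : Type u} [Ring R] [Ring Q] {φ : R →+* Q}

theorem IsLeftFlatBimorphism.injective (hφ : IsLeftFlatBimorphism φ) :
    Function.Injective φ := by
  have := hφ.mono
  exact (ConcreteCategory.mono_iff_injective_of_preservesPullback (RingCat.ofHom φ)).1 this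

/-- Restriction of scalars along a left flat bimorphism preserves flatness of projective
modules. -/
theorem IsLeftFlatBimorphism.isFlatModule_of_projective (hφ : IsLeftFlatBimorphism φ)
    (P : ModuleCat.{u} Q) [Module.Projective Q P] :
    IsFlatModule ((ModuleCat.restrictScalars φ).obj P) := by
  obtain ⟨s, hs⟩ := Module.projective_def'.1 (inferInstance : Module.Projective Q P)
  let ev (x : P) : P →ₗ[Q] Q := (Finsupp.lapply x).comp s
  let ι (x : P) : Q →ₗ[Q] P := LinearMap.toSpanSingleton Q P x
  refine hφ.flat.of_dualBasis (X := P)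
    (fun x => ((ModuleCat.restrictScalars φ).map (ModuleCat.ofHom (ev x))).hom)
    (fun x => ((ModuleCat.restrictScalars φ).map (Y := P) (ModuleCat.ofHom (ι x))).hom)
    fun m => ?_
  refine ⟨(s m).support, fun T hT => ?_⟩
  have h := LinearMap.congr_fun hs m
  change Finsupp.linearCombination Q id (s m) = m at h
  rw [Finsupp.linearCombination_apply,
    Finsupp.sum_of_support_subset _ hT _ (by simp)] at h
  exact h

/-- An additive map between `Q`-modules which is linear over an epimorphism `φ : R → Q` is
`Q`-linear. -/
theorem map_smul_of_epi (h : Epi (RingCat.ofHom φ)) {V W : Type u} [AddCommGroup V]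
    [AddCommGroup W] [Module Q V] [Module Q W] (f : V →+ W)
    (hf : ∀ r v, f (φ r • v) = φ r • f v) (q : Q) (v : V) : f (q • v) = q • f v := by
  let α : Q →+* AddMonoid.End (V × W) := Module.toAddMonoidEnd Q (V × W)
  -- `b` is the diagonal action conjugated by the shear `(v, w) ↦ (v, w + f v)`. The two actions
  -- agree on `φ(R)`, hence on `Q`; evaluating at `(v, 0)` gives linearity.
  let b (q : Q) : AddMonoid.End (V × W) :=
    { toFun x := (q • x.1, q • x.2 + (f (q • x.1) - q • f x.1))
      map_zero' := by simp
      map_add' x y := by ext <;> simp; abel }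
  have hb (q : Q) (x : V × W) : b q x = (q • x.1, q • x.2 + (f (q • x.1) - q • f x.1)) := rfl
  let β : Q →+* AddMonoid.End (V × W) :=
    { toFun := b
      map_one' := AddMonoidHom.ext fun x => by
        change b 1 x = x
        simp [hb]
      map_mul' p q := AddMonoidHom.ext fun x => by
        change b (p * q) x = b p (b q x)
        simp only [hb, mul_smul, smul_sub, smul_add]
        congr 1
        abel
      map_zero' := AddMonoidHom.ext fun x => by
        change b 0 x = 0
        simp [hb]
      map_add' p q := AddMonoidHom.ext fun x => by
        change b (p + q) x = b p x + b q x
        simp only [hb, add_smul, Prod.mk_add_mk, map_add]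
        congr 1
        abel }
  have hαβ : RingCat.ofHom φ ≫ RingCat.ofHom α = RingCat.ofHom φ ≫ RingCat.ofHom β := by
    ext r : 2
    refine AddMonoidHom.ext fun x => ?_
    change (φ r • x.1, φ r • x.2) = (φ r • x.1, φ r • x.2 + (f (φ r • x.1) - φ r • f x.1))
    simp [hf]
  have hq := congrArg (fun g => g.hom q) ((cancel_epi _).1 hαβ)
  have := congrArg Prod.snd (DFunLike.congr_fun hq (v, (0 : W)))
  change q • (0 : W) = q • (0 : W) + (f (q • v) - q • f v) at this
  rw [smul_zero, zero_add] at this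
  exact sub_eq_zero.1 this.symm

/-- Writing `1 = ∑ φ(rᵢ) qᵢ` with `rᵢ ∈ I` gives `v = ∑ rᵢ (qᵢ v)`. -/
theorem classD_restrictScalars (V : ModuleCat.{u} Q) :
    classD φ ((ModuleCat.restrictScalars φ).obj V) := by
  intro I hI
  rw [eq_top_iff]
  rintro v -
  have hI : Submodule.span Qᵐᵒᵖ (φ '' (I : Set R)) = ⊤ := hI
  have key (q : Q) (hq : q ∈ Submodule.span Qᵐᵒᵖ (φ '' (I : Set R))) : ∀ v : V,
      q • v ∈ AddSubgroup.closure {x : (ModuleCat.restrictScalars φ).obj V |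
        ∃ r ∈ I, ∃ d : (ModuleCat.restrictScalars φ).obj V, x = r • d} := by
    induction hq using Submodule.span_induction with
    | mem q hq =>
      obtain ⟨r, hr, rfl⟩ := hq
      exact fun v => AddSubgroup.subset_closure ⟨r, hr, v, rfl⟩
    | zero => intro v; rw [zero_smul]; exact zero_mem _
    | add p q _ _ hp hq => intro v; rw [add_smul]; exact add_mem (hp v) (hq v)
    | smul p q _ hq =>
      intro v
      have : (p • q) • v = q • (p.unop • v) := by rw [← mul_smul]; rfl
      rw [this]
      exact hq _
  exact one_smul Q (show V from v) ▸ key 1 (hI ▸ Submodule.mem_top) v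

/-- Every injective module is `h`-divisible. -/
theorem classHD_of_injective (hφ : Function.Injective φ) (E : ModuleCat.{u} R) [Injective E] :
    classHD φ E := by
  refine ⟨(ModuleCat.coextendScalars φ).obj E,
    ((ModuleCat.restrictCoextendScalarsAdj φ).counit.app E).hom, fun e => ?_⟩
  let j : ModuleCat.of R R ⟶ (ModuleCat.restrictScalars φ).obj (ModuleCat.of Q Q) :=
    ModuleCat.ofHom (Y := (ModuleCat.restrictScalars φ).obj (ModuleCat.of Q Q))
      { toFun := φ
        map_add' := map_add φ
        map_smul' := map_mul φ }
  have : Mono j := (ModuleCat.mono_iff_injective j).2 hφ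
  let g : ModuleCat.of R R ⟶ E := ModuleCat.ofHom (LinearMap.toSpanSingleton R E e)
  -- The counit `Hom_R(Q, E) → E` is evaluation at `1`; an extension of `r ↦ r e` along `φ` is a
  -- preimage of `e`.
  refine ⟨(ModuleCat.CoextendScalars.equiv φ E).symm (Injective.factorThru g j).hom, ?_⟩
  change (Injective.factorThru g j).hom (1 : Q) = e
  have h := congrArg (fun k => k.hom (1 : R)) (Injective.comp_factorThru g j)
  have h1 : j.hom (1 : R) = (1 : Q) := map_one φ
  simp only [ModuleCat.hom_comp, LinearMap.comp_apply, h1] at h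
  rw [h]
  exact one_smul R e

/-- Embed `N` in an injective `E`. As `Ext²(M, E) = 0`, each class in `Ext²(M, N)` comes from
`Ext¹(M, E/N)`, and `E/N` is `h`-divisible because `E` is. -/
theorem leftPerp_classHD_le_classP1 (hφ : Function.Injective φ) :
    leftPerp (classHD φ) ≤ classP1 R := by
  intro M hM
  rw [classP1]
  refine (projectiveDimension_le_iff M 1).2 ?_
  refine hasProjectiveDimensionLT_of_enoughInjectives M 2 fun N => ⟨fun x y => ?_⟩
  suffices h : ∀ x : Abelian.Ext.{u} M N 2, x = 0 by rw [h x, h y]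
  intro x
  obtain ⟨p⟩ := EnoughInjectives.presentation N
  have hS : (ShortComplex.mk _ _ (Limits.cokernel.condition p.f)).ShortExact :=
    { exact := ShortComplex.exact_cokernel p.f }
  obtain ⟨y, rfl⟩ := Abelian.Ext.covariant_sequence_exact₁ M hS x
    (Abelian.Ext.eq_zero_of_injective _) rfl
  have hy : classHD φ (Limits.cokernel p.f) := by
    have := p.injective
    obtain ⟨V, f, hf⟩ := classHD_of_injective hφ p.J
    exact ⟨V, (Limits.cokernel.π p.f).hom.comp f,
      ((ModuleCat.epi_iff_surjective (Limits.cokernel.π p.f)).1 inferInstance).comp hf⟩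
  have := hM _ hy
  rw [Subsingleton.elim y 0, Abelian.Ext.zero_comp]

/-- If `Ext¹(M, K)` vanishes, then every extension of `M` by `K` splits. -/
theorem exists_retraction_of_subsingleton_ext {K F M : ModuleCat.{u} R} (i : K →ₗ[R] F)
    (p : F →ₗ[R] M) (hi : Function.Injective i) (hip : Function.Exact i p)
    (hp : Function.Surjective p) [Subsingleton (Abelian.Ext.{u} M K 1)] :
    ∃ r : F →ₗ[R] K, r ∘ₗ i = LinearMap.id := by
  let S : ShortComplex (ModuleCat.{u} R) :=
    ShortComplex.mk (ModuleCat.ofHom i) (ModuleCat.ofHom p)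
      (by ext x; exact hip.apply_apply_eq_zero x)
  have hS : S.ShortExact := ModuleCat.shortComplex_shortExact S hip hi hp
  -- The obstruction to extending the identity of `K` along `i` lies in `Ext¹(M, K)`.
  obtain ⟨x, hx⟩ := Abelian.Ext.contravariant_sequence_exact₁ hS K (Abelian.Ext.mk₀ (𝟙 K)) rfl
    (Subsingleton.elim (α := Abelian.Ext.{u} M K 1) _ _)
  obtain ⟨r, rfl⟩ := (Abelian.Ext.mk₀_bijective _ _).2 x
  rw [Abelian.Ext.mk₀_comp_mk₀] at hx
  have h := (Abelian.Ext.mk₀_bijective _ _).1 hx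
  exact ⟨r.hom, congrArg ModuleCat.Hom.hom h⟩

/-- If modules of weak dimension at most one are orthogonal to divisible modules, then
projective modules over `Q` are relatively injective for injections between them. -/
theorem IsLeftFlatBimorphism.exists_retraction (hφ : IsLeftFlatBimorphism φ)
    (h : classF1 R ≤ leftPerp (classD φ)) (K F : Type u) [AddCommGroup K] [AddCommGroup F]
    [Module Q K] [Module Q F] [Module.Projective Q K] [Module.Projective Q F]
    (i : K →ₗ[Q] F) (hi : Function.Injective i) : ∃ r : F →ₗ[Q] K, r ∘ₗ i = LinearMap.id := by
  let res := ModuleCat.restrictScalars.{u} φ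
  let K' := ModuleCat.of Q K
  let F' := ModuleCat.of Q F
  let M' := ModuleCat.of Q (F ⧸ LinearMap.range i)
  let i' : res.obj K' →ₗ[R] res.obj F' := (res.map (ModuleCat.ofHom i)).hom
  let p' : res.obj F' →ₗ[R] res.obj M' :=
    (res.map (ModuleCat.ofHom (LinearMap.range i).mkQ)).hom
  have hp' : Function.Surjective p' := (LinearMap.range i).mkQ_surjective
  have hip' : Function.Exact i' p' := LinearMap.exact_map_mkQ_range i
  have hM : classF1 R (res.obj M') :=
    ⟨res.obj K', res.obj F', i', p',
      hφ.isFlatModule_of_projective K', hφ.isFlatModule_of_projective F', hi, hip', hp'⟩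
  have := h _ hM _ (classD_restrictScalars K')
  obtain ⟨r, hr⟩ := exists_retraction_of_subsingleton_ext i' p' hi hip' hp'
  exact ⟨{ toFun := r
           map_add' := map_add r
           map_smul' := map_smul_of_epi hφ.epi (V := F) (W := K) r.toAddMonoidHom
            fun c v => r.map_smul c v },
    LinearMap.ext fun x => LinearMap.congr_fun hr x⟩

end Bimorphism

/-! ### Vanishing of the finitistic dimension -/

section FinitisticDimension

variable {Q : Type u} [Ring Q]

theorem exists_section_of_retraction {K F M : Type*} [AddCommGroup K] [AddCommGroup F]
    [AddCommGroup M] [Module Q K] [Module Q F] [Module Q M] {i : K →ₗ[Q] F} {p : F →ₗ[Q] M}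
    (hip : Function.Exact i p) (hi : Function.Injective i) (hp : Function.Surjective p)
    (r : F →ₗ[Q] K) (hr : r ∘ₗ i = LinearMap.id) : ∃ s : M →ₗ[Q] F, p ∘ₗ s = LinearMap.id :=
  have h : (∃ s, p ∘ₗ s = LinearMap.id) ↔ ∃ r, r ∘ₗ i = LinearMap.id :=
    (Function.Exact.split_tfae hip hi hp).out 0 1
  h.2 ⟨r, hr⟩

/-- By induction on the dimension the first syzygy is projective, so its inclusion into a free
module splits and the module is a direct summand of that free module. -/
theorem leftFdimEqZero_of_exists_retraction
    (h : ∀ (K F : Type u) [AddCommGroup K] [AddCommGroup F] [Module Q K] [Module Q F]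
      [Module.Projective Q K] [Module.Projective Q F] (i : K →ₗ[Q] F),
      Function.Injective i → ∃ r : F →ₗ[Q] K, r ∘ₗ i = LinearMap.id) :
    LeftFdimEqZero Q := by
  have key (n : ℕ) : ∀ M : ModuleCat.{u} Q, HasProjectiveDimensionLT M (n + 1) →
      Projective M := by
    induction n with
    | zero => exact fun M hM => projective_iff_hasProjectiveDimensionLT_one.2 hM
    | succ n ih =>
      intro M hM
      let p : (M →₀ Q) →ₗ[Q] M := Finsupp.linearCombination Q id
      have hp : Function.Surjective p := Finsupp.linearCombination_id_surjective Q M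
      have hS := LinearMap.shortExact_shortComplexKer hp
      have hF : Projective (ModuleCat.of Q (M →₀ Q)) :=
        (IsProjective.iff_projective (R := Q) (M →₀ Q)).1 inferInstance
      have hK := ih _ ((hS.hasProjectiveDimensionLT_X₃_iff n hF).1 hM)
      have hK' : Module.Projective Q (LinearMap.ker p) :=
        (IsProjective.iff_projective (R := Q) (LinearMap.ker p)).2 hK
      obtain ⟨r, hr⟩ := h (LinearMap.ker p) (M →₀ Q) (LinearMap.ker p).subtype
        (LinearMap.ker p).subtype_injective
      have hex : Function.Exact (LinearMap.ker p).subtype p := LinearMap.exact_subtype_ker_map p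
      obtain ⟨s, hs⟩ := exists_section_of_retraction (K := LinearMap.ker p)
        (i := (LinearMap.ker p).subtype) hex (LinearMap.ker p).subtype_injective hp r hr
      exact (IsProjective.iff_projective (R := Q) M).1 (Module.Projective.of_split s p hs)
  intro M
  by_cases hM : projectiveDimension M = ⊤
  · exact .inr hM
  · obtain ⟨n, hn⟩ := (projectiveDimension_ne_top_iff M).1 hM
    exact .inl ((projectiveDimension_le_iff M 0).2
      ((projective_iff_hasProjectiveDimensionLE_zero M).1 (key n M hn)))

end FinitisticDimension

/-! ### Bass's chain condition on principal right ideals -/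

section Perfect

variable {Q : Type u} [Ring Q]

/-- The descending chain condition on principal right ideals; `y ∣ x` means `x ∈ y Q`. -/
def DCCPrincipalRight (Q : Type*) [Ring Q] : Prop :=
  WellFounded fun x y : Q => y ∣ x ∧ ¬ x ∣ y

theorem DCCPrincipalRight.exists_minimal (h : DCCPrincipalRight Q) (s : Set Q)
    (hs : s.Nonempty) : ∃ x ∈ s, ∀ y ∈ s, x ∣ y → y ∣ x := by
  obtain ⟨x, hx, hmin⟩ := h.has_min s hs
  exact ⟨x, hx, fun y hy hxy => not_not.1 fun hyx => hmin y hy ⟨hxy, hyx⟩⟩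

theorem DCCPrincipalRight.of_surjective {S : Type*} [Ring S] (h : DCCPrincipalRight Q)
    (f : Q →+* S) (hf : Function.Surjective f) : DCCPrincipalRight S := by
  refine WellFounded.wellFounded_iff_has_min.2 fun s ⟨z, hz⟩ => ?_
  obtain ⟨w, rfl⟩ := hf z
  obtain ⟨x, hx, hmin⟩ := h.exists_minimal (f ⁻¹' s) ⟨w, hz⟩
  refine ⟨f x, hx, ?_⟩
  rintro _ hy ⟨⟨c, rfl⟩, hc⟩
  obtain ⟨c, rfl⟩ := hf c
  rw [← map_mul] at hy hc
  exact hc (map_dvd f (hmin _ hy (dvd_mul_right x c)))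

/-- If injections between projective modules split, then principal right ideals satisfy the
descending chain condition. -/
theorem dccPrincipalRight_of_exists_retraction
    (h : ∀ (K F : Type u) [AddCommGroup K] [AddCommGroup F] [Module Q K] [Module Q F]
      [Module.Projective Q K] [Module.Projective Q F] (i : K →ₗ[Q] F),
      Function.Injective i → ∃ r : F →ₗ[Q] K, r ∘ₗ i = LinearMap.id) :
    DCCPrincipalRight Q := by
  refine wellFounded_iff_isEmpty_descending_chain.2 ⟨fun ⟨x, hx⟩ => ?_⟩
  choose a ha using fun n => (hx n).1
  -- The cokernel of `i` is the direct limit of `Q → Q → ⋯` under right multiplication by the `a n`.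
  -- Iterating the relation that a retraction satisfies expands `r(e₀)` with coefficients `p n = a₀
  -- ⋯ aₙ₋₁`.
  let i : (ℕ →₀ Q) →ₗ[Q] (ℕ →₀ Q) := Finsupp.linearCombination Q fun n =>
    Finsupp.single n 1 - Finsupp.single (n + 1) (a n)
  have i_single (n : ℕ) : i (Finsupp.single n 1) =
      Finsupp.single n 1 - a n • Finsupp.single (n + 1) 1 := by
    simp [i]
  have i_zero (f : ℕ →₀ Q) : i f 0 = f 0 := by
    induction f using Finsupp.induction_linear with
    | zero => simp
    | add f g hf hg => simp [hf, hg]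
    | single n q => by_cases hn : n = 0 <;> simp [i, hn]
  have i_succ (f : ℕ →₀ Q) (k : ℕ) : i f (k + 1) = f (k + 1) - f k * a k := by
    induction f using Finsupp.induction_linear with
    | zero => simp
    | add f g hf hg => simp only [map_add, Finsupp.add_apply, hf, hg, add_mul]; abel
    | single n q =>
      by_cases hn : n = k
      · subst hn; simp [i]
      · simp [i, Finsupp.single_apply, hn]
  have hi : Function.Injective i := by
    refine (injective_iff_map_eq_zero i).2 fun f hf => Finsupp.ext fun k => ?_
    induction k with
    | zero => rw [← i_zero, hf]
    | succ k ih =>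
      have := i_succ f k
      rw [hf, ih] at this
      simpa using this.symm
  obtain ⟨r, hr⟩ := h (ℕ →₀ Q) (ℕ →₀ Q) i hi
  have hstep (n : ℕ) : r (Finsupp.single n 1) =
      Finsupp.single n 1 + a n • r (Finsupp.single (n + 1) 1) := by
    have := LinearMap.congr_fun hr (Finsupp.single n 1)
    rw [LinearMap.comp_apply, i_single, map_sub, map_smul, LinearMap.id_apply,
      sub_eq_iff_eq_add] at this
    exact this
  let p : ℕ → Q := fun n => ((List.range n).map a).prod
  have p_succ (n : ℕ) : p (n + 1) = p n * a n := List.prod_range_succ a n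
  have hx_p (n : ℕ) : x n = x 0 * p n := by
    induction n with
    | zero => simp [p]
    | succ n ih => rw [ha, p_succ, ih, mul_assoc]
  have hexp (n : ℕ) : r (Finsupp.single 0 1) =
      ∑ k ∈ Finset.range n, Finsupp.single k (p k) + p n • r (Finsupp.single n 1) := by
    induction n with
    | zero => simp [p]
    | succ n ih =>
      rw [ih, hstep n, Finset.sum_range_succ, p_succ, smul_add, mul_smul, add_assoc]
      simp
  obtain ⟨N, hN⟩ : ∃ N, r (Finsupp.single 0 1) N = 0 := by
    obtain ⟨N, hN⟩ := Infinite.exists_notMem_finset (r (Finsupp.single 0 1)).support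
    exact ⟨N, by simpa using hN⟩
  -- Coordinate `N` of `r(e₀)` vanishes by finite support. The expansion to `N + 1` is the first
  -- whose sum contains `p N`, and it puts `p N` in `p (N + 1) Q`, against strictness of the chain.
  have hp : p N + p (N + 1) * r (Finsupp.single (N + 1) 1) N = 0 := by
    rw [← hN, hexp (N + 1)]
    simp [Finsupp.single_apply]
  refine (hx N).2 ⟨-(r (Finsupp.single (N + 1) 1) N), ?_⟩
  rw [hx_p N, hx_p (N + 1), mul_assoc, mul_neg, ← eq_neg_of_add_eq_zero_left hp]

/-! ### The Jacobson radical and semisimplicity -/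

theorem mem_jacobson_iff_forall_isMaximal {x : Q} :
    x ∈ Ring.jacobson Q ↔ ∀ m : Ideal Q, m.IsMaximal → x ∈ m := by
  rw [Ring.jacobson_eq_sInf_isMaximal, Submodule.mem_sInf]
  rfl

/-- No maximal left ideal contains `1 - x`, so it has a left inverse `s`. Then `s = 1 + s x` has the
same form and is itself left invertible, which makes `s` a two-sided inverse. -/
theorem isUnit_one_sub_of_mem_jacobson {x : Q} (hx : x ∈ Ring.jacobson Q) : IsUnit (1 - x) := by
  have key : ∀ y ∈ Ring.jacobson Q, ∃ s, s * (1 - y) = 1 := by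
    intro y hy
    by_contra! hs
    have hne : Ideal.span {1 - y} ≠ ⊤ := fun htop => by
      obtain ⟨s, hs'⟩ := Ideal.mem_span_singleton'.1 (htop ▸ Submodule.mem_top : (1 : Q) ∈ _)
      exact hs s hs'
    obtain ⟨m, hm, hle⟩ := Ideal.exists_le_maximal _ hne
    refine hm.ne_top ((Ideal.eq_top_iff_one m).2 ?_)
    have h1 : 1 - y ∈ m := hle (Ideal.mem_span_singleton_self _)
    simpa using add_mem h1 (Ring.jacobson_le_of_isMaximal m hy)
  obtain ⟨s, hs⟩ := key x hx
  obtain ⟨t, ht⟩ := key (-(s * x)) (neg_mem (Ideal.mul_mem_left _ s hx))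
  have hs' : 1 - -(s * x) = s := by
    rw [mul_sub, mul_one, sub_eq_iff_eq_add] at hs
    rw [sub_neg_eq_add, ← hs]
  rw [hs'] at ht
  have : t = 1 - x := calc
    t = t * (s * (1 - x)) := by rw [hs, mul_one]
    _ = 1 - x := by rw [← mul_assoc, ht, one_mul]
  exact ⟨⟨1 - x, s, this ▸ ht, hs⟩, rfl⟩

/-- An element `b` such that all `1 - b r` are right invertible lies in the radical. -/
theorem mem_jacobson_of_forall_right_inverse {b : Q} (hb : ∀ r, ∃ t, (1 - b * r) * t = 1) :
    b ∈ Ring.jacobson Q := by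
  refine mem_jacobson_iff_forall_isMaximal.2 fun m hm => ?_
  by_contra hbm
  have htop : Ideal.span {b} ⊔ m = ⊤ := by
    rw [sup_comm]
    exact hm.1.2 _ (left_lt_sup.2 fun hle => hbm (hle (Ideal.mem_span_singleton_self b)))
  obtain ⟨y, hy, f, hf, hyf⟩ := Submodule.mem_sup.1 (htop ▸ Submodule.mem_top : (1 : Q) ∈ _)
  obtain ⟨r, rfl⟩ := Ideal.mem_span_singleton'.1 hy
  obtain ⟨t, ht⟩ := hb r
  -- The right inverse `t` again has the form `1 - b r'`, so it is right invertible and hence a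
  -- two-sided inverse of `1 - b r`. Then `1 + r t b` is a left inverse of `f = 1 - r b`, which lies
  -- in `m`.
  have ht1 : t = 1 - b * -(r * t) := by
    rw [sub_mul, one_mul, mul_assoc, sub_eq_iff_eq_add] at ht
    rwa [mul_neg, sub_neg_eq_add]
  obtain ⟨t', ht'⟩ := hb (-(r * t))
  rw [← ht1] at ht'
  have htt : t * (1 - b * r) = 1 := by
    have : t' = 1 - b * r := calc
      t' = (1 - b * r) * t * t' := by rw [ht, one_mul]
      _ = 1 - b * r := by rw [mul_assoc, ht', mul_one]
    rw [← this, ht']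
  refine hm.ne_top ((Ideal.eq_top_iff_one m).2 ?_)
  have h1 : (1 + r * t * b) * f = 1 := by
    rw [eq_sub_of_add_eq' hyf]
    calc (1 + r * t * b) * (1 - r * b)
        = 1 - r * b + r * (t * (1 - b * r)) * b := by noncomm_ring
      _ = 1 := by rw [htt, mul_one, sub_add_cancel]
  exact h1 ▸ Ideal.mul_mem_left _ _ hf

/-- A ring with zero Jacobson radical satisfying the descending chain condition on
principal left ideals is semisimple. -/
theorem isSemisimpleRing_of_wellFounded {S : Type*} [Ring S]
    (wf : WellFounded fun x y : S => (∃ s, x = s * y) ∧ ¬ ∃ s, y = s * x)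
    (hrad : ∀ b : S, b ≠ 0 → ∃ m : Ideal S, m.IsMaximal ∧ b ∉ m) : IsSemisimpleRing S := by
  have hmin (A : Set S) (hA : A.Nonempty) :
      ∃ x ∈ A, ∀ y ∈ A, (∃ s, y = s * x) → ∃ s, x = s * y := by
    obtain ⟨x, hx, hmin⟩ := wf.has_min A hA
    exact ⟨x, hx, fun y hy hxy => not_not.1 fun hyx => hmin y hy ⟨hxy, hyx⟩⟩
  refine (isSemisimpleModule_iff S S).2 ⟨fun I => ?_⟩
  -- For minimal `a`, `S a` is a complement of `I`. Otherwise a minimal `b` in the intersection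
  -- satisfies `S b ∩ m = 0`, so `1 = e + f` along `S b ⊕ m` with `e` idempotent. Replacing `a` by
  -- `a f` keeps the sum with `I`, so minimality forces `a e = 0`; since `e = w a`, this gives `e =
  -- e² = 0`.
  obtain ⟨a, ha, hmina⟩ := hmin {a | Ideal.span {a} ⊔ I = ⊤} ⟨1, by simp⟩
  refine ⟨Ideal.span {a}, IsCompl.symm ⟨?_, codisjoint_iff.2 ha⟩⟩
  rw [disjoint_iff, eq_bot_iff]
  by_contra hne
  obtain ⟨b', ⟨hb'a, hb'I⟩, hb'0⟩ := SetLike.not_le_iff_exists.1 hne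
  obtain ⟨b, ⟨hb0, hba, hbI⟩, hminb⟩ :=
    hmin {b | b ≠ 0 ∧ b ∈ Ideal.span {a} ∧ b ∈ I} ⟨b', hb'0, hb'a, hb'I⟩
  obtain ⟨m, hm, hbm⟩ := hrad b hb0
  have hdisj (c : S) (hc : ∃ s, c = s * b) (hcm : c ∈ m) : c = 0 := by
    by_contra hc0
    obtain ⟨s, rfl⟩ := hc
    obtain ⟨t, ht⟩ := hminb _ ⟨hc0, Ideal.mul_mem_left _ s hba, Ideal.mul_mem_left _ s hbI⟩ ⟨s, rfl⟩
    exact hbm (ht ▸ Ideal.mul_mem_left _ t hcm)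
  have htop : Ideal.span {b} ⊔ m = ⊤ := by
    rw [sup_comm]
    exact hm.1.2 _ (left_lt_sup.2 fun hle => hbm (hle (Ideal.mem_span_singleton_self b)))
  obtain ⟨e, he, f, hf, hef⟩ := Submodule.mem_sup.1 (htop ▸ Submodule.mem_top : (1 : S) ∈ _)
  obtain ⟨t, rfl⟩ := Ideal.mem_span_singleton'.1 he
  set e := t * b with he_def
  have hee : e * f = 0 := by
    refine hdisj _ ⟨t - e * t, ?_⟩ (Ideal.mul_mem_left _ e hf)
    rw [← eq_sub_iff_add_eq'] at hef
    rw [hef, mul_sub, mul_one, sub_mul, mul_assoc e t b]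
  have he0 : e ≠ 0 := fun h0 => hm.ne_top ((Ideal.eq_top_iff_one m).2 (by simpa [← hef, h0] using hf))
  have heI : e ∈ I := Ideal.mul_mem_left _ t hbI
  obtain ⟨w, hw⟩ := Ideal.mem_span_singleton'.1 (Ideal.mul_mem_left _ t hba : e ∈ Ideal.span {a})
  have haf : a = a * e + a * f := by rw [← mul_add, hef, mul_one]
  obtain ⟨s, hs⟩ := hmina (a * f) (by
    refine eq_top_iff.2 (ha.symm.le.trans (sup_le ?_ le_sup_right))
    rw [Ideal.span_singleton_le_iff_mem, haf]
    exact add_mem (Ideal.mem_sup_right (Ideal.mul_mem_left _ a heI))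
      (Ideal.mem_sup_left (by rw [← haf]; exact Ideal.mem_span_singleton_self _)))
    ⟨1 - a * w, by
      rw [sub_mul, one_mul, mul_assoc, hw]
      exact (eq_sub_of_add_eq' haf.symm)⟩
  have hfe : f * e = 0 := by
    have h1 : f = 1 - e := (eq_sub_of_add_eq' hef)
    rw [h1, mul_sub, mul_one, sub_eq_zero] at hee
    rw [h1, sub_mul, one_mul, ← hee, sub_self]
  have hae : a * e = 0 := by rw [hs, mul_assoc, mul_assoc, hfe, mul_zero, mul_zero]
  refine he0 ?_
  calc e = e * (e + f) := by rw [hef, mul_one]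
    _ = e * e := by rw [mul_add, hee, add_zero]
    _ = w * a * e := by rw [hw]
    _ = 0 := by rw [mul_assoc, hae, mul_zero]

/-- The chain condition passes to `Q/J` and becomes one on left ideals of the opposite ring, whose
radical vanishes by left-right symmetry of the Jacobson radical. -/
theorem DCCPrincipalRight.isSemisimpleRing_quotient_jacobson (h : DCCPrincipalRight Q) :
    IsSemisimpleRing (Q ⧸ Ring.jacobson Q) := by
  have hd : DCCPrincipalRight (Q ⧸ Ring.jacobson Q) :=
    h.of_surjective (Ideal.Quotient.mk _) Ideal.Quotient.mk_surjective
  rw [← isSemisimpleRing_mulOpposite_iff]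
  refine isSemisimpleRing_of_wellFounded ?_ fun b hb => ?_
  · refine Subrelation.wf ?_ (InvImage.wf MulOpposite.unop hd)
    rintro x y ⟨⟨s, rfl⟩, hn⟩
    exact ⟨⟨s.unop, rfl⟩, fun ⟨s, hs⟩ => hn ⟨MulOpposite.op s, MulOpposite.unop_injective hs⟩⟩
  · by_contra! hm
    refine hb (MulOpposite.unop_injective ?_)
    have : b.unop ∈ Ring.jacobson (Q ⧸ Ring.jacobson Q) := by
      refine mem_jacobson_of_forall_right_inverse fun r => ?_
      have hx : b ∈ Ring.jacobson (Q ⧸ Ring.jacobson Q)ᵐᵒᵖ :=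
        mem_jacobson_iff_forall_isMaximal.2 hm
      have := (isUnit_one_sub_of_mem_jacobson
        (Ideal.mul_mem_left _ (MulOpposite.op r) hx)).unop.exists_right_inv
      simpa using this
    simpa using this

/-! ### Nakayama's lemma and projective covers -/

/-- If `c = c j q` then `c (1 - j q) = 0`, and `1 - j q` is a unit. -/
theorem eq_zero_of_mul_jacobson_dvd {c j : Q}
    (hj : j ∈ Ring.jacobson Q) (hc : c * j ∣ c) : c = 0 := by
  obtain ⟨q, hq⟩ := hc
  refine (isUnit_one_sub_of_mem_jacobson (Ideal.mul_mem_right q _ hj)).mul_left_eq_zero.1 ?_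
  rw [mul_sub, mul_one, ← mul_assoc, ← hq, sub_self]

theorem DCCPrincipalRight.isNilpotent_of_mem_jacobson (h : DCCPrincipalRight Q) {x : Q}
    (hx : x ∈ Ring.jacobson Q) : IsNilpotent x := by
  obtain ⟨_, ⟨n, rfl⟩, hmin⟩ := h.exists_minimal (Set.range (x ^ ·)) ⟨_, 0, rfl⟩
  refine ⟨n, eq_zero_of_mul_jacobson_dvd hx ?_⟩
  exact hmin _ ⟨n + 1, pow_succ x n⟩ (dvd_mul_right _ _)

/-- Nakayama's lemma for arbitrary modules over a ring with the descending chain condition on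
principal right ideals. -/
theorem DCCPrincipalRight.eq_top_of_sup_jacobson_smul (h : DCCPrincipalRight Q) {M : Type*}
    [AddCommGroup M] [Module Q M] (N : Submodule Q M)
    (hN : N ⊔ Ring.jacobson Q • (⊤ : Submodule Q M) = ⊤) : N = ⊤ := by
  by_contra hne
  obtain ⟨m₀, -, hm₀⟩ := SetLike.not_le_iff_exists.1 (mt eq_top_iff.2 hne)
  -- Take `c Q` minimal with `c M ⊄ N`. Since `M = N + J M`, some `c j m'` with `j ∈ J` lies outside
  -- `N`; minimality gives `c ∈ c j Q`, hence `c = 0`.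
  obtain ⟨c, ⟨m, hm⟩, hmin⟩ := h.exists_minimal {c | ∃ m : M, c • m ∉ N} ⟨1, m₀, by simpa⟩
  obtain ⟨n, hn, w, hw, rfl⟩ := Submodule.mem_sup.1 (hN ▸ Submodule.mem_top : m ∈ _)
  have hcw : c • w ∉ N := fun hcw => hm (by rw [smul_add]; exact add_mem (N.smul_mem c hn) hcw)
  refine hcw (Submodule.smul_induction_on hw (fun j hj m' _ => ?_) fun x y hx hy => ?_)
  · by_contra hj'
    rw [← mul_smul] at hj'
    have := eq_zero_of_mul_jacobson_dvd hj (hmin _ ⟨m', hj'⟩ (dvd_mul_right c j))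
    simp [this] at hj'
  · rw [smul_add]
    exact add_mem hx hy

/-- A complement of `m/J` in `Q/J` is generated by an idempotent, which lifts to `e'` because `J` is
nil. The cover is `Q e' → Q/m`, and an element of its kernel lies in `J`, hence in `J e'`. -/
theorem DCCPrincipalRight.exists_projective_cover_quotient (h : DCCPrincipalRight Q)
    (m : Ideal Q) [hm : m.IsMaximal] :
    ∃ (P : Submodule Q Q) (f : P →ₗ[Q] Q ⧸ m), Module.Projective Q P ∧ Function.Surjective f ∧
      LinearMap.ker f ≤ Ring.jacobson Q • (⊤ : Submodule Q P) := by
  have := h.isSemisimpleRing_quotient_jacobson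
  set J := Ring.jacobson Q
  have hJm : J ≤ m := Ring.jacobson_le_of_isMaximal m
  have hss : IsSemisimpleModule Q (Q ⧸ J) :=
    (LinearMap.isSemisimpleModule_iff_of_bijective (σ := Ideal.Quotient.mk J)
      ({ toFun := id, map_add' := fun _ _ => rfl, map_smul' := fun _ _ => rfl } :
        Q ⧸ J →ₛₗ[Ideal.Quotient.mk J] Q ⧸ J) Function.bijective_id).2 inferInstance
  obtain ⟨I, hI⟩ := exists_isCompl (Submodule.map J.mkQ m)
  obtain ⟨y, hy, z, hz, hfz⟩ :=
    Submodule.mem_sup.1 (hI.sup_eq_top ▸ Submodule.mem_top : J.mkQ 1 ∈ _)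
  obtain ⟨f, hf, rfl⟩ := Submodule.mem_map.1 hy
  obtain ⟨e, he⟩ : ∃ e, e = 1 - f := ⟨_, rfl⟩
  have heI : J.mkQ e ∈ I := by
    rw [he, map_sub, ← hfz, add_sub_cancel_left]
    exact hz
  have hmem {x : Q} (hx : x ∈ m) (hxI : J.mkQ x ∈ I) : x ∈ J := by
    have : J.mkQ x ∈ Submodule.map J.mkQ m ⊓ I := ⟨Submodule.mem_map_of_mem hx, hxI⟩
    rw [hI.inf_eq_bot, Submodule.mem_bot] at this
    exact (Submodule.Quotient.mk_eq_zero J).1 this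
  have hidem : IsIdempotentElem (Ideal.Quotient.mk J e) := by
    have h1 : e * f ∈ J := by
      refine hmem (Ideal.mul_mem_left _ _ hf) ?_
      have : e * f = f • e := by rw [he, smul_eq_mul, sub_mul, mul_sub, one_mul, mul_one]
      rw [this, map_smul]
      exact I.smul_mem _ heI
    rw [IsIdempotentElem, ← map_mul, Ideal.Quotient.eq]
    have : e * e - e = -(e * f) := by rw [he]; noncomm_ring
    rw [this]
    exact neg_mem h1
  obtain ⟨e', he', hee'⟩ := exists_isIdempotentElem_eq_of_ker_isNilpotent (Ideal.Quotient.mk J)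
    (fun x hx => h.isNilpotent_of_mem_jacobson (by rwa [Ideal.mk_ker] at hx)) _ ⟨e, rfl⟩ hidem
  rw [Ideal.Quotient.eq] at hee'
  let ρ : Q →ₗ[Q] Q := LinearMap.toSpanSingleton Q Q e'
  have hρ (x : LinearMap.range ρ) : x.1 * e' = x.1 := by
    obtain ⟨_, y, rfl⟩ := x
    change y * e' * e' = y * e'
    rw [mul_assoc, he'.eq]
  refine ⟨LinearMap.range ρ, m.mkQ ∘ₗ (LinearMap.range ρ).subtype,
    Module.Projective.of_split (LinearMap.range ρ).subtype ρ.rangeRestrict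
      (LinearMap.ext fun x => Subtype.ext (hρ x)), fun q => ?_, fun x hx => ?_⟩
  · obtain ⟨q, rfl⟩ := m.mkQ_surjective q
    refine ⟨⟨q * e', q, rfl⟩, (Submodule.Quotient.eq m).2 ?_⟩
    have : q * e' - q = q * (e' - e) - q * f := by rw [he]; noncomm_ring
    change q * e' - q ∈ m
    rw [this]
    exact sub_mem (Ideal.mul_mem_left _ _ (hJm hee')) (Ideal.mul_mem_left _ _ hf)
  · have hxm : x.1 ∈ m := (Submodule.Quotient.mk_eq_zero m).1 hx
    have h1 : x.1 * e ∈ J := by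
      refine hmem ?_ ?_
      · rw [he, mul_sub, mul_one]
        exact sub_mem hxm (Ideal.mul_mem_left _ _ hf)
      · rw [← smul_eq_mul, map_smul]
        exact I.smul_mem _ heI
    have hxJ : x.1 ∈ J := by
      rw [← hρ x, ← sub_add_cancel (x.1 * e') (x.1 * e), ← mul_sub]
      exact add_mem (Ideal.mul_mem_left _ _ hee') h1
    have : x = x.1 • (⟨e', 1, one_mul e'⟩ : LinearMap.range ρ) := Subtype.ext (hρ x).symm
    rw [this]
    exact Submodule.smul_mem_smul hxJ Submodule.mem_top

/-- `M/JM` is a direct sum of simple modules, and the sum `P` of their covers maps onto it with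
kernel in `J P`. A lift `P → M` is surjective with superfluous kernel, both by Nakayama. -/
theorem DCCPrincipalRight.isLeftPerfect (h : DCCPrincipalRight Q) : IsLeftPerfect Q := by
  classical
  intro M
  have := h.isSemisimpleRing_quotient_jacobson
  set J := Ring.jacobson Q
  have htors : Module.IsTorsionBySet Q (M ⧸ (J • ⊤ : Submodule Q M)) J :=
    (Module.isTorsionBySet_quotient_ideal_smul M J)
  have hss : IsSemisimpleModule Q (M ⧸ (J • ⊤ : Submodule Q M)) :=
    letI := htors.module
    htors.isSemisimpleModule_iff.1 inferInstance
  obtain ⟨s, e, -, hs⟩ := hss.exists_linearEquiv_dfinsupp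
  have hcover (N : s) : ∃ (P : Submodule Q Q) (f : P →ₗ[Q] N.1), Module.Projective Q P ∧
      Function.Surjective f ∧ LinearMap.ker f ≤ J • (⊤ : Submodule Q P) := by
    obtain ⟨m, hm, ⟨e⟩⟩ := isSimpleModule_iff_quot_maximal.1 (hs N)
    obtain ⟨P, f, hP, hf, hker⟩ := h.exists_projective_cover_quotient m
    refine ⟨P, e.symm.toLinearMap ∘ₗ f, hP, e.symm.surjective.comp hf, ?_⟩
    rwa [LinearEquiv.ker_comp]
  choose P f hP hf hker using hcover
  let π : (Π₀ N, P N) →ₗ[Q] M ⧸ (J • ⊤ : Submodule Q M) :=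
    e.symm.toLinearMap ∘ₗ DFinsupp.mapRange.linearMap f
  have hπ : Function.Surjective π :=
    e.symm.surjective.comp ((DFinsupp.mapRange_surjective _ fun N => map_zero (f N)).2 hf)
  have hπker : LinearMap.ker π ≤ J • ⊤ := by
    intro p hp
    have hp' : DFinsupp.mapRange.linearMap f p = 0 := e.symm.map_eq_zero_iff.1 hp
    rw [← DFinsupp.sum_single (f := p)]
    refine sum_mem fun N _ => ?_
    have hN : p N ∈ J • (⊤ : Submodule Q (P N)) := hker N (DFunLike.congr_fun hp' N)
    have := Submodule.mem_map_of_mem (f := DFinsupp.lsingle (R := Q) (M := fun N => P N) N) hN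
    rw [Submodule.map_smul''] at this
    exact Submodule.smul_mono le_rfl le_top this
  obtain ⟨g, hg⟩ := Module.projective_lifting_property (J • ⊤ : Submodule Q M).mkQ π
    (Submodule.mkQ_surjective _)
  refine ⟨ModuleCat.of Q (Π₀ N, P N), g, inferInstanceAs (Module.Projective Q (Π₀ N, P N)),
    ?_, fun N hN => ?_⟩
  · refine LinearMap.range_eq_top.1 (h.eq_top_of_sup_jacobson_smul _ (eq_top_iff.2 fun x _ => ?_))
    obtain ⟨p, hp⟩ := hπ ((J • ⊤ : Submodule Q M).mkQ x)
    rw [← hg, LinearMap.comp_apply] at hp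
    have hx := (Submodule.Quotient.eq _).1 hp.symm
    rw [← add_sub_cancel (g p) x]
    exact Submodule.add_mem_sup ⟨p, rfl⟩ hx
  · refine h.eq_top_of_sup_jacobson_smul N (eq_top_iff.2 (hN.symm.le.trans ?_))
    refine sup_le_sup_left (le_trans (fun p hp => ?_) hπker) N
    rw [LinearMap.mem_ker, ← hg, LinearMap.comp_apply, LinearMap.mem_ker.1 hp, map_zero]

end Perfect

end FlatBimorphism

end

theorem proposition4p4 {R Q : Type u} [Ring R] [Ring Q] (φ : R →+* Q)
    (hφ : FlatBimorphism.IsLeftFlatBimorphism φ) :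
    (FlatBimorphism.leftPerp (FlatBimorphism.classHD φ) ≤ FlatBimorphism.classP1 R) ∧
    (FlatBimorphism.classF1 R = FlatBimorphism.leftPerp (FlatBimorphism.classD φ) →
      FlatBimorphism.LeftFdimEqZero Q ∧ FlatBimorphism.IsLeftPerfect Q) :=
  ⟨FlatBimorphism.leftPerp_classHD_le_classP1 hφ.injective, fun h =>
    ⟨FlatBimorphism.leftFdimEqZero_of_exists_retraction (hφ.exists_retraction h.le),
      (FlatBimorphism.dccPrincipalRight_of_exists_retraction
        (hφ.exists_retraction h.le)).isLeftPerfect⟩⟩
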